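/- For $n \ge 1$, a Stirling permutation of order $n$ is a word $w = w(1)\cdots w(2n)$ in which each of $1,\dots,n$ occurs exactly twice and such that every letter standing between the two occurrences of a letter $a$ is larger than $a$. A value $w(i)$ with $2 \le i \le 2n-2$ and $w(i-1) < w(i) = w(i+1) > w(i+2)$ is called a mesa of $w$, and $\mathrm{Mesa}(w) \subseteq [n] = \{1,\dots,n\}$ denotes the set of mesas of $w$. A set $M \subseteq [n]$ is an admissible mesa set of order $n$ if $M = \mathrm{Mesa}(w)$ for some Stirling permutation $w$ of order $n$; let $\mathrm{AMS}_n$ be the set of all of these. For positive integers $m, \ell$ let $C_{m,\ell} = \frac{1}{\ell}\binom{\ell+m-1}{m}$ be the rational Catalan number. Let $n \ge 1$ be an integer, written as $n = 3k + r$ with $r \in \{0,1,2\}$ and $k$ a nonnegative integer. Then $$|\mathrm{AMS}_n| = 2^{n-1} - \sum_{i=0}^{k-1} 2^{3i+r}\, C_{2(k-i)-1,\,k-i}.$$ -/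

import Mathlib

/-- `w` is a Stirling permutation of order `n`, written as the word `w(1) ⋯ w(2n)`: each of
`1, …, n` occurs exactly twice and no other letter occurs, and every letter `b` standing
(not necessarily adjacently) between the two occurrences of a letter `a` is larger than `a`. -/
def IsStirlingPerm (n : ℕ) (w : List ℕ) : Prop :=
  (∀ x, w.count x = if x ∈ Finset.Icc 1 n then 2 else 0) ∧
    ∀ a b, [a, b, a].Sublist w → a < b

/-- `x` is a mesa of the word `w`: there are four consecutive letters
`w(i-1) < w(i) = w(i+1) > w(i+2)` in `w` with `w(i) = x`. -/
def IsMesa (w : List ℕ) (x : ℕ) : Prop :=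
  ∃ a b, a < x ∧ b < x ∧ [a, x, x, b] <:+: w

open Classical in
/-- `Mesa(w) = {x ∈ [n] : x is a mesa of w}`, for a word `w` with letters in `[n]`. -/
noncomputable def mesaSet (n : ℕ) (w : List ℕ) : Finset ℕ :=
  (Finset.Icc 1 n).filter (fun x => IsMesa w x)

open Classical in
/-- The admissible mesa sets of order `n`: the sets `M ⊆ [n]` such that `Mesa(w) = M` for some
Stirling permutation `w` of order `n`. -/
noncomputable def admissibleMesaSets (n : ℕ) : Finset (Finset ℕ) :=
  (Finset.Icc 1 n).powerset.filter (fun M => ∃ w, IsStirlingPerm n w ∧ mesaSet n w = M)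

/-- The rational Catalan number `C_{m,l} = (1/l) * binom(l+m-1, m)` (for positive `m` and `l`). -/
def rationalCatalan (m l : ℕ) : ℚ :=
  (1 / (l : ℚ)) * ((l + m - 1).choose m : ℚ)

/-!
A set `M ⊆ [n]` is an admissible mesa set if and only if `3 * |M ∩ [t]| < 2 * t` for all
`1 ≤ t ≤ n` (`mem_admissibleMesaSets_iff`).

*Necessity* (`three_mul_card_mesas_lt`). Restrict the word to its letters `≤ t`. This keeps every
mesa `x ≤ t`, and leaves a word of length `2 * t` in which the mesas occupy `2 * |M ∩ [t]|`
places. Two distinct mesas are never adjacent: each of the two would have to be smaller than the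
other. So no three consecutive letters are mesas; as the first and the last letter are not mesas
either, `3 * (2 * |M ∩ [t]|) ≤ 2 * (2 * t - 2) + 2`.

*Sufficiency* (`exists_stirlingPerm_isMesa_iff`). Build the word by inserting the letters
`1, 2, …` in this order, each as an adjacent pair. A non-mesa goes to the end of the word, where it
changes no mesa. A mesa `n + 1` goes into one of the `2 * n - 1` inner gaps. This destroys another
mesa only if the gap is one of the three inside the window `a x x b` of a mesa `x`, and the
inequality for `t = n + 1` says precisely that these windows do not use up all the gaps.

*Counting*. Read `M` as a walk with a step `-1` for each element of `M` and `+2` for each other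
element of `[n]`. The walk starts at `0` and must be positive after every step, so its first step
is `+2`, and `|AMS_n|` is the number of walks of `n - 1` steps from height `2` that stay positive.
All other walks of `n - 1` steps hit `0`, since the walk descends by one unit at a time. Sorting
them by the time `3 * m - 1` of the first visit to `0` gives the sum in the theorem
(`survivingWalks_add_sum`), because the hitting time formula `u * F(h, u) = h * binom(u, j)` for
`u = h + 3 * j` (`mul_hittingWalks`) evaluates the number of first passages from height `2` as a
rational Catalan number (`hittingWalks_two`).
-/

/-! ### Windows of mesas -/

/-- In a word with only two copies of `x`, standing in the window `a x x b`, each copy of `x` is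
followed by `x` or by `b`. -/
theorem eq_or_eq_of_pair_infix {w : List ℕ} {a b x y : ℕ} (hw : w.count x ≤ 2)
    (h : [a, x, x, b] <:+: w) (hy : [x, y] <:+: w) : y = x ∨ y = b := by
  obtain ⟨p, s, rfl⟩ := h
  obtain ⟨p', s', h⟩ := hy
  have hq : x ∉ p ++ [a] ∧ x ∉ b :: s := by
    rw [← List.count_eq_zero, ← List.count_eq_zero]
    simp only [List.count_append, List.count_cons, List.count_nil, beq_self_eq_true,
      if_true] at hw ⊢
    omega
  have h' : p' ++ (x :: y :: s') = (p ++ [a]) ++ (x :: x :: b :: s) := by simpa using h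
  rcases List.append_eq_append_iff.1 h' with ⟨e, h1, h2⟩ | ⟨e, h1, h2⟩
  · rcases e with _ | ⟨c, e⟩
    · simp at h2
      exact Or.inl h2.1
    · simp only [List.cons_append, List.cons.injEq] at h2
      exact absurd (by rw [h1, ← h2.1]; simp) hq.1
  · rcases e with _ | ⟨c, _ | ⟨d, e⟩⟩
    · simp at h2
      exact Or.inl h2.1.symm
    · simp at h2
      exact Or.inr h2.2.1.symm
    · simp only [List.cons_append, List.cons.injEq] at h2
      exact absurd (by rw [h2.2.2]; simp) hq.2

theorem IsMesa.reverse {w : List ℕ} {x : ℕ} (h : IsMesa w x) : IsMesa w.reverse x := by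
  obtain ⟨a, b, ha, hb, h⟩ := h
  exact ⟨b, a, hb, ha, by simpa using List.reverse_infix.2 h⟩

theorem IsMesa.le_of_pair_infix {w : List ℕ} {x y : ℕ} (hw : w.count x ≤ 2) (hx : IsMesa w x)
    (hy : [x, y] <:+: w) : y ≤ x := by
  obtain ⟨a, b, ha, hb, h⟩ := hx
  rcases eq_or_eq_of_pair_infix hw h hy with rfl | rfl
  · exact le_rfl
  · exact hb.le

/-- Distinct mesas are never adjacent: a letter next to a mesa `x` is at most `x`. -/
theorem eq_of_mesa_pair_infix {w : List ℕ} {x y : ℕ} (hw : ∀ x, w.count x ≤ 2)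
    (hx : IsMesa w x) (hy : IsMesa w y) (h : [x, y] <:+: w) : x = y :=
  le_antisymm
    (hy.reverse.le_of_pair_infix (by simpa using hw y) (by simpa using List.reverse_infix.2 h))
    (hx.le_of_pair_infix (hw x) h)

theorem not_isMesa_head {w : List ℕ} {x : ℕ} (hw : (x :: w).count x ≤ 2) :
    ¬ IsMesa (x :: w) x := by
  rintro ⟨a, b, ha, hb, p, s, h⟩
  rcases p with _ | ⟨c, p⟩
  · simp at h
    omega
  · simp only [List.cons_append, List.cons.injEq] at h
    rw [← h.2] at hw
    simp only [List.count_append, List.count_cons, List.count_nil, beq_self_eq_true,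
      if_true] at hw
    omega

theorem not_isMesa_last {w : List ℕ} {x : ℕ} (hw : (w ++ [x]).count x ≤ 2) :
    ¬ IsMesa (w ++ [x]) x := by
  intro h
  have h' := h.reverse
  rw [List.reverse_append, List.reverse_singleton, List.singleton_append] at h'
  refine not_isMesa_head ?_ h'
  simpa using hw

/-! ### Necessity of the prefix inequalities -/

/-- If no three consecutive letters satisfy `P`, then at most two thirds of the letters do, up to
a boundary term; equality holds for the pattern `P P ¬P P P ¬P ⋯ P P`. -/
theorem three_mul_countP_le (P : ℕ → Bool) :
    ∀ l : List ℕ, (∀ x y z, [x, y, z] <:+: l → ¬ (P x ∧ P y ∧ P z)) →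
      3 * l.countP P ≤ 2 * l.length + 2
  | [], _ => by simp
  | [x], _ => by
    have := List.countP_le_length (p := P) (l := [x])
    simp only [List.length_cons, List.length_nil] at this ⊢
    omega
  | [x, y], _ => by
    have := List.countP_le_length (p := P) (l := [x, y])
    simp only [List.length_cons, List.length_nil] at this ⊢
    omega
  | x :: y :: z :: l, h => by
    have h0 := h x y z ⟨[], l, by simp⟩
    have h1 := three_mul_countP_le P (y :: z :: l)
      fun a b c hi => h a b c (hi.trans (List.suffix_cons _ _).isInfix)
    have h2 := three_mul_countP_le P (z :: l)
      fun a b c hi => h a b c (hi.trans (List.IsSuffix.isInfix ⟨[x, y], by simp⟩))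
    have h3 := three_mul_countP_le P l
      fun a b c hi => h a b c (hi.trans (List.IsSuffix.isInfix ⟨[x, y, z], by simp⟩))
    simp only [List.countP_cons, List.length_cons] at *
    cases hx : P x <;> cases hy : P y <;> cases hz : P z <;>
      simp only [hx, hy, hz, if_true, Bool.false_eq_true, if_false, and_self, not_true_eq_false]
        at h0 h1 h2 ⊢ <;> omega

theorem length_eq_two_mul_card {l : List ℕ} {S : Finset ℕ}
    (h : ∀ x, l.count x = if x ∈ S then 2 else 0) : l.length = 2 * S.card := by
  have hS : l.toFinset = S := by
    ext x
    rw [List.mem_toFinset, ← List.count_pos_iff, h]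
    split_ifs <;> simp_all
  rw [← List.sum_toFinset_count_eq_length, hS, Finset.sum_congr rfl fun x hx => by
    rw [h, if_pos hx], Finset.sum_const, smul_eq_mul, mul_comm]

/-- The bound on the number of mesas. It needs only that every letter of `[t]` occurs exactly
twice, not the Stirling condition. -/
theorem three_mul_card_mesas_lt {t : ℕ} {w : List ℕ} {M : Finset ℕ} (ht : 1 ≤ t)
    (hw : ∀ x, w.count x = if x ∈ Finset.Icc 1 t then 2 else 0) (hM : M ⊆ Finset.Icc 1 t)
    (h : ∀ x ∈ M, IsMesa w x) : 3 * M.card < 2 * t := by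
  have hlen : w.length = 2 * t := by simpa using length_eq_two_mul_card hw
  have hcount : w.countP (· ∈ M) = 2 * M.card := by
    rw [List.countP_eq_length_filter]
    refine length_eq_two_mul_card fun x => ?_
    by_cases hx : x ∈ M
    · rw [List.count_filter (by simpa using hx), hw, if_pos (hM hx), if_pos hx]
    · rw [if_neg hx, List.count_eq_zero]
      simp [hx]
  have hle : ∀ x, w.count x ≤ 2 := fun x => by rw [hw]; split_ifs <;> simp
  obtain ⟨x, l, rfl⟩ := List.exists_cons_of_ne_nil (l := w) (by rintro rfl; simp at hlen; omega)
  rcases List.eq_nil_or_concat l with rfl | ⟨l, y, rfl⟩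
  · simp at hlen
    omega
  rw [List.concat_eq_append] at *
  have hx : x ∉ M := fun hx => not_isMesa_head (hle x) (h x hx)
  have hy : y ∉ M := fun hy =>
    not_isMesa_last (w := x :: l) (by simpa using hle y) (by simpa using h y hy)
  -- Applying the bound to the word without its two end letters makes the final inequality strict.
  have key := three_mul_countP_le (fun x => decide (x ∈ M)) l ?_
  · simp [List.countP_append, hx, hy] at hcount hlen
    omega
  · intro a b c hi hP
    simp only [decide_eq_true_eq] at hP
    obtain ⟨ha, hb, hc⟩ := hP
    have hi' : [a, b, c] <:+: x :: (l ++ [y]) :=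
      hi.trans ⟨[x], [y], by simp⟩
    obtain rfl := eq_of_mesa_pair_infix hle (h _ ha) (h _ hb)
      (List.IsInfix.trans ⟨[], [c], by simp⟩ hi')
    obtain rfl := eq_of_mesa_pair_infix hle (h _ ha) (h _ hc)
      (List.IsInfix.trans ⟨[a], [], by simp⟩ hi')
    have := hi'.sublist.count_le a
    have := hle a
    simp at *
    omega

theorem mem_mesaSet {n : ℕ} {w : List ℕ} {x : ℕ} :
    x ∈ mesaSet n w ↔ x ∈ Finset.Icc 1 n ∧ IsMesa w x := by
  classical
  exact Finset.mem_filter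

theorem three_mul_card_inter_mesaSet_lt {n t : ℕ} {w : List ℕ} (hw : IsStirlingPerm n w)
    (ht : t ∈ Finset.Icc 1 n) : 3 * (mesaSet n w ∩ Finset.Icc 1 t).card < 2 * t := by
  rw [Finset.mem_Icc] at ht
  refine three_mul_card_mesas_lt (w := w.filter (· ≤ t)) ht.1 (fun x => ?_)
    Finset.inter_subset_right fun x hx => ?_
  · by_cases hx : x ≤ t
    · rw [List.count_filter (by simpa using hx), hw.1]
      simp only [Finset.mem_Icc]
      congr 1
      simp
      omega
    · rw [if_neg (by simp [hx]), List.count_eq_zero]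
      simp [hx]
  · simp only [Finset.mem_inter, mem_mesaSet, Finset.mem_Icc] at hx
    obtain ⟨⟨-, a, b, ha, hb, h⟩, -, hxt⟩ := hx
    refine ⟨a, b, ha, hb, ?_⟩
    have := h.filter (fun y => decide (y ≤ t))
    simpa [hxt, ha.le.trans hxt, hb.le.trans hxt] using this

/-! ### Construction of a word with prescribed mesas -/

theorem infix_or_infix_of_notMem {l u v : List ℕ} {m : ℕ} (hm : m ∉ l)
    (h : l <:+: u ++ m :: v) : l <:+: u ∨ l <:+: v := by
  obtain ⟨p, s, h⟩ := h
  rcases List.append_eq_append_iff.1 h with ⟨e, rfl, -⟩ | ⟨e, h1, h2⟩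
  · exact Or.inl ⟨p, e, rfl⟩
  · rcases e with _ | ⟨c, e⟩
    · exact Or.inl ⟨p, [], by simpa using h1⟩
    · simp only [List.cons_append, List.cons.injEq] at h2
      obtain ⟨rfl, rfl⟩ := h2
      rcases List.append_eq_append_iff.1 h1 with ⟨f, -, rfl⟩ | ⟨f, -, h3⟩
      · simp at hm
      · rcases f with _ | ⟨c, f⟩
        · simp at h3
          exact absurd (by rw [← h3]; simp) hm
        · simp only [List.cons_append, List.cons.injEq] at h3
          exact Or.inr ⟨f, s, by rw [h3.2]⟩

theorem IsMesa.mono {u w : List ℕ} {x : ℕ} (h : IsMesa u x) (hu : u <:+: w) : IsMesa w x := by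
  obtain ⟨a, b, ha, hb, h⟩ := h
  exact ⟨a, b, ha, hb, h.trans hu⟩

theorem IsStirlingPerm.mem_iff {n : ℕ} {w : List ℕ} (hw : IsStirlingPerm n w) {x : ℕ} :
    x ∈ w ↔ x ∈ Finset.Icc 1 n := by
  rw [← List.count_pos_iff, hw.1]
  split_ifs <;> simp_all

theorem IsStirlingPerm.insert {n : ℕ} {u v : List ℕ} (hw : IsStirlingPerm n (u ++ v)) :
    IsStirlingPerm (n + 1) (u ++ (n + 1) :: (n + 1) :: v) := by
  have hn : n + 1 ∉ u ++ v := by simp [hw.mem_iff]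
  rw [List.mem_append, not_or] at hn
  refine ⟨fun x => ?_, fun a b h => ?_⟩
  · have := hw.1 x
    rcases eq_or_ne x (n + 1) with rfl | hx
    · simp [List.count_eq_zero.2 hn.1, List.count_eq_zero.2 hn.2]
    · simp only [List.count_append, List.count_cons, beq_iff_eq, hx.symm, if_false,
        Finset.mem_Icc, add_zero] at this ⊢
      rw [this]
      congr 1
      simp
      omega
  · rcases eq_or_ne a (n + 1) with rfl | ha
    · exfalso
      obtain ⟨l₁, l₂, h1, h2, h3⟩ := List.sublist_append_iff.1 h
      rcases l₁ with _ | ⟨c, l₁⟩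
      · rw [List.nil_append] at h1
        rw [← h1, List.cons_sublist_cons] at h3
        rcases List.sublist_cons_iff.1 h3 with h4 | ⟨r, h4, h5⟩
        · exact hn.2 (h4.subset (by simp))
        · simp only [List.cons.injEq] at h4
          exact hn.2 (h5.subset (by simp [← h4.2]))
      · simp only [List.cons_append, List.cons.injEq] at h1
        exact hn.1 (h2.subset (by simp [h1.1]))
    · have hmem : a ∈ u ++ v := by
        have := h.subset (List.mem_cons_self)
        simpa [ha] using this
      rcases eq_or_ne b (n + 1) with rfl | hb
      · have := hw.mem_iff.1 hmem
        simp at this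
        omega
      · have hu : u.filter (fun c => decide (c ≠ n + 1)) = u :=
          List.filter_eq_self.2 fun c hc => by
            simpa using ne_of_mem_of_not_mem hc hn.1
        have hv : v.filter (fun c => decide (c ≠ n + 1)) = v :=
          List.filter_eq_self.2 fun c hc => by
            simpa using ne_of_mem_of_not_mem hc hn.2
        have h' := h.filter (fun c => decide (c ≠ n + 1))
        simp only [List.filter_append, hu, hv, List.filter_cons, ha, hb, List.filter_nil,
          ne_eq, not_false_eq_true, decide_true, not_true_eq_false, decide_false, if_true,
          Bool.false_eq_true, if_false] at h'
        exact hw.2 a b h'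

/-- Inserting a pair of large letters creates no mesa other than that letter: the window of a
smaller mesa contains no large letter. -/
theorem isMesa_of_isMesa_insert {u v : List ℕ} {m x : ℕ} (hx : x < m)
    (h : IsMesa (u ++ m :: m :: v) x) : IsMesa (u ++ v) x := by
  obtain ⟨a, b, ha, hb, h⟩ := h
  have hm : m ∉ [a, x, x, b] := by simp; omega
  refine ⟨a, b, ha, hb, ?_⟩
  rcases infix_or_infix_of_notMem hm h with h | h
  · exact h.trans (List.prefix_append _ _).isInfix
  · rcases infix_or_infix_of_notMem (u := []) hm h with h | h
    · simp at h
    · exact h.trans (List.suffix_append _ _).isInfix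

/-- A gap of the word is identified with the number `g` of letters to its left. If `3 * |M| < n`,
one of the gaps `1, …, n` lies inside no mesa window, so that each mesa survives in one of the two
parts into which this gap cuts the word. -/
theorem exists_free_gap {n : ℕ} {w : List ℕ} {M : Finset ℕ} (hM : ∀ x ∈ M, IsMesa w x)
    (hcard : 3 * M.card < n) :
    ∃ g, 1 ≤ g ∧ g ≤ n ∧ ∀ x ∈ M, IsMesa (w.take g) x ∨ IsMesa (w.drop g) x := by
  -- `i x` is the number of letters to the left of a window of `x`.
  have hpos : ∀ x, ∃ i, x ∈ M → ∃ a b p s, a < x ∧ b < x ∧ p.length = i ∧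
      w = p ++ [a, x, x, b] ++ s := by
    intro x
    by_cases hx : x ∈ M
    · obtain ⟨a, b, ha, hb, p, s, h⟩ := hM x hx
      exact ⟨p.length, fun _ => ⟨a, b, p, s, ha, hb, rfl, h.symm⟩⟩
    · exact ⟨0, fun h => absurd h hx⟩
  choose i hi using hpos
  obtain ⟨g, hg, hgM⟩ := Finset.exists_mem_notMem_of_card_lt_card
    (s := M.biUnion fun x => {i x + 1, i x + 2, i x + 3}) (t := Finset.Icc 1 n) (by
      rw [Nat.card_Icc, Nat.add_sub_cancel]
      refine lt_of_le_of_lt (Finset.card_biUnion_le_card_mul M _ 3 fun x _ => ?_) (by omega)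
      exact Finset.card_le_three)
  rw [Finset.mem_Icc] at hg
  refine ⟨g, hg.1, hg.2, fun x hx => ?_⟩
  simp only [Finset.mem_biUnion, Finset.mem_insert, Finset.mem_singleton, not_exists, not_and,
    not_or] at hgM
  have hgx := hgM x hx
  obtain ⟨a, b, p, s, ha, hb, hp, rfl⟩ := hi x hx
  rcases (by omega : g ≤ p.length ∨ p.length + 4 ≤ g) with hg' | hg'
  · refine Or.inr ⟨a, b, ha, hb, p.drop g, s, ?_⟩
    rw [List.append_assoc, List.append_assoc, List.drop_append_of_le_length hg']
  · refine Or.inl ⟨a, b, ha, hb, p, s.take (g - (p.length + 4)), ?_⟩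
    rw [List.take_append, List.take_of_length_le (l := p ++ [a, x, x, b]) (by simpa using hg')]
    simp

theorem exists_stirlingPerm_isMesa_iff {n : ℕ} {M : Finset ℕ} (hM : M ⊆ Finset.Icc 1 n)
    (h : ∀ t ∈ Finset.Icc 1 n, 3 * (M ∩ Finset.Icc 1 t).card < 2 * t) :
    ∃ w, IsStirlingPerm n w ∧ ∀ x, IsMesa w x ↔ x ∈ M := by
  induction n generalizing M with
  | zero =>
    obtain rfl : M = ∅ := by simpa using hM
    exact ⟨[], ⟨by simp, by simp⟩, by simp [IsMesa]⟩
  | succ n ih =>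
    have hsub : M.erase (n + 1) ⊆ Finset.Icc 1 n := fun x hx => by
      have h1 := Finset.mem_Icc.1 (hM (Finset.mem_of_mem_erase hx))
      have h2 := Finset.ne_of_mem_erase hx
      rw [Finset.mem_Icc]
      omega
    obtain ⟨w, hw, hwM⟩ := ih hsub fun t ht => by
      rw [Finset.mem_Icc] at ht
      refine lt_of_le_of_lt ?_ (h t (Finset.mem_Icc.2 (by omega)))
      gcongr
      exact Finset.erase_subset _ _
    have hlen : w.length = 2 * n := by simpa using length_eq_two_mul_card hw.1
    have hlt : ∀ {w' : List ℕ}, IsStirlingPerm (n + 1) w' → ∀ x, IsMesa w' x → x ≤ n + 1 := by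
      rintro w' hw' x ⟨a, b, -, -, hx⟩
      exact (Finset.mem_Icc.1 (hw'.mem_iff.1 (hx.subset (by simp)))).2
    by_cases hn : n + 1 ∈ M
    · have hcard : 3 * (M.erase (n + 1)).card < 2 * n - 1 := by
        have h1 := h (n + 1) (by simp)
        rw [Finset.inter_eq_left.2 hM] at h1
        have := Finset.card_erase_add_one hn
        omega
      obtain ⟨g, hg1, hg2, hg⟩ := exists_free_gap (fun x hx => (hwM x).2 hx) hcard
      have hst : IsStirlingPerm (n + 1) (w.take g ++ (n + 1) :: (n + 1) :: w.drop g) :=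
        IsStirlingPerm.insert (by rwa [List.take_append_drop])
      refine ⟨_, hst, fun x => ⟨fun hx => ?_, fun hx => ?_⟩⟩
      · rcases (hlt hst x hx).eq_or_lt with rfl | hx'
        · exact hn
        · have := isMesa_of_isMesa_insert hx' hx
          rw [List.take_append_drop] at this
          exact Finset.mem_of_mem_erase ((hwM x).1 this)
      · rcases eq_or_ne x (n + 1) with rfl | hx'
        · have hg3 : g - 1 < w.length := by omega
          have hg4 : g < w.length := by omega
          have hle : ∀ y ∈ w, y < n + 1 := fun y hy => by
            have := Finset.mem_Icc.1 (hw.mem_iff.1 hy)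
            omega
          refine ⟨w[g - 1], w[g], hle _ (List.getElem_mem _), hle _ (List.getElem_mem _),
            w.take (g - 1), w.drop (g + 1), ?_⟩
          rw [List.drop_eq_getElem_cons hg4]
          obtain ⟨g, rfl⟩ : ∃ g', g = g' + 1 := ⟨g - 1, by omega⟩
          rw [List.take_succ_eq_append_getElem (i := g) (by omega)]
          simp [-List.take_append_getElem]
        · rcases hg x (Finset.mem_erase.2 ⟨hx', hx⟩) with h1 | h1
          · exact h1.mono (List.prefix_append _ _).isInfix
          · exact h1.mono (List.IsSuffix.isInfix ⟨w.take g ++ [n + 1, n + 1], by simp⟩)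
    · rw [Finset.erase_eq_of_notMem hn] at hwM
      have hst : IsStirlingPerm (n + 1) (w ++ [n + 1, n + 1]) :=
        IsStirlingPerm.insert (v := []) (by simpa using hw)
      refine ⟨_, hst, fun x => ⟨fun hx => ?_, fun hx => ?_⟩⟩
      · rcases (hlt hst x hx).eq_or_lt with rfl | hx'
        · refine absurd (a := IsMesa ((w ++ [n + 1]) ++ [n + 1]) (n + 1)) (by simpa using hx)
            (not_isMesa_last ?_)
          have := hst.1 (n + 1)
          simp at this ⊢
          omega
        · have := isMesa_of_isMesa_insert (v := []) hx' hx
          rw [List.append_nil] at this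
          exact (hwM x).1 this
      · exact ((hwM x).2 hx).mono (List.prefix_append _ _).isInfix

/-- Admissible mesa sets are characterized by the prefix inequalities. -/
theorem mem_admissibleMesaSets_iff {n : ℕ} {M : Finset ℕ} :
    M ∈ admissibleMesaSets n ↔ M ⊆ Finset.Icc 1 n ∧
      ∀ t ∈ Finset.Icc 1 n, 3 * (M ∩ Finset.Icc 1 t).card < 2 * t := by
  have hmem : M ∈ admissibleMesaSets n ↔
      M ⊆ Finset.Icc 1 n ∧ ∃ w, IsStirlingPerm n w ∧ mesaSet n w = M := by
    classical
    rw [← Finset.mem_powerset]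
    exact Finset.mem_filter
  rw [hmem]
  refine and_congr_right fun hM => ⟨?_, fun h => ?_⟩
  · rintro ⟨w, hw, rfl⟩ t ht
    exact three_mul_card_inter_mesaSet_lt hw ht
  · obtain ⟨w, hw, hwM⟩ := exists_stirlingPerm_isMesa_iff hM h
    refine ⟨w, hw, ?_⟩
    ext x
    rw [mem_mesaSet, hwM]
    exact ⟨fun h => h.2, fun h => ⟨hM h, h⟩⟩

/-! ### Counting the sets satisfying the prefix inequalities -/

/-- `survivingWalks h s` is the number of walks of `s` steps in `{-1, +2}` from height `h` all of
whose heights, the initial one included, are positive. -/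
def survivingWalks : ℕ → ℕ → ℕ
  | 0, _ => 0
  | _ + 1, 0 => 1
  | h + 1, s + 1 => survivingWalks h s + survivingWalks (h + 3) s

/-- `hittingWalks h u` is the number of walks with steps in `{-1, +2}` from height `h` that visit
height `0` for the first time after exactly `u` steps. -/
def hittingWalks : ℕ → ℕ → ℕ
  | 0, 0 => 1
  | 0, _ + 1 => 0
  | _ + 1, 0 => 0
  | h + 1, s + 1 => hittingWalks h s + hittingWalks (h + 3) s

/-- Every walk of `s` steps either stays positive or hits `0` at a first time `u ≤ s`, after which
its `s - u` remaining steps are free. -/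
theorem survivingWalks_add_sum (h s : ℕ) :
    survivingWalks h s + ∑ u ∈ Finset.range (s + 1), hittingWalks h u * 2 ^ (s - u) = 2 ^ s := by
  induction s generalizing h with
  | zero => cases h <;> simp [survivingWalks, hittingWalks]
  | succ s ih =>
    rw [Finset.sum_range_succ']
    cases h with
    | zero => simp [survivingWalks, hittingWalks]
    | succ h =>
      simp only [survivingWalks, hittingWalks, Nat.add_sub_add_right, zero_mul, add_zero, add_mul,
        Finset.sum_add_distrib, pow_succ]
      have h1 := ih h
      have h2 := ih (h + 3)
      omega

theorem hittingWalks_eq_zero {h u : ℕ} (hu : ∀ j, u ≠ h + 3 * j) : hittingWalks h u = 0 := by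
  induction u generalizing h with
  | zero =>
    cases h with
    | zero => exact absurd rfl (hu 0)
    | succ h => rfl
  | succ u ih =>
    cases h with
    | zero => rfl
    | succ h =>
      rw [hittingWalks, ih fun j hj => hu j (by omega), ih fun j hj => hu (j + 1) (by omega)]

/-- The hitting time formula: among the walks of `u = h + 3 * j` steps from `h` to `0`, of which
there are `binom(u, j)`, the proportion `h / u` reaches `0` only at the end. -/
theorem mul_hittingWalks (h j : ℕ) :
    (h + 3 * j) * hittingWalks h (h + 3 * j) = h * (h + 3 * j).choose j := by
  obtain ⟨u, hu⟩ : ∃ u, u = h + 3 * j := ⟨_, rfl⟩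
  induction u generalizing h j with
  | zero =>
    obtain rfl : h = 0 := by omega
    obtain rfl : j = 0 := by omega
    simp
  | succ u ih =>
    rcases h with _ | h
    · rw [← hu]
      simp [hittingWalks]
    · rw [← hu, hittingWalks]
      rcases j with _ | j
      · obtain rfl : u = h := by omega
        have h1 := ih u 0 rfl
        rw [hittingWalks_eq_zero (h := u + 3) fun j => by omega]
        rcases u with _ | u
        · simp [hittingWalks]
        · simp only [mul_zero, add_zero, Nat.choose_zero_right, mul_one] at h1 ⊢
          rw [Nat.eq_of_mul_eq_mul_left (by omega) (h1.trans (mul_one _).symm), mul_one]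
      · obtain rfl : u = h + 3 * j + 3 := by omega
        have h1 := ih h (j + 1) (by ring)
        have h2 := ih (h + 3) j (by ring)
        have h3 := Nat.choose_succ_right_eq (h + 3 * j + 3) j
        rw [show h + 3 * j + 3 - j = h + 2 * j + 3 by omega] at h3
        rw [show h + 3 * (j + 1) = h + 3 * j + 3 by ring] at h1
        rw [show h + 3 + 3 * j = h + 3 * j + 3 by ring] at h2
        rw [Nat.choose_succ_succ' (h + 3 * j + 3) j]
        -- With `N = h + 3 * j + 3`, the inductive hypotheses give `N` times the two summands.
        refine Nat.eq_of_mul_eq_mul_left (show 0 < h + 3 * j + 3 by omega) ?_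
        linear_combination (h + 3 * j + 4) * (h1 + h2) + 3 * h3.symm

theorem hittingWalks_two (j : ℕ) :
    (hittingWalks 2 (3 * j + 2) : ℚ) = rationalCatalan (2 * (j + 1) - 1) (j + 1) := by
  have h1 := mul_hittingWalks 2 j
  have h2 := Nat.add_one_mul_choose_eq (3 * j + 1) (2 * j + 1)
  have h3 : (3 * j + 2).choose (2 * j + 2) = (3 * j + 2).choose j := by
    rw [← Nat.choose_symm (by omega)]
    congr 1
    omega
  rw [show 3 * j + 1 + 1 = 3 * j + 2 by ring, show 2 * j + 1 + 1 = 2 * j + 2 by ring, h3] at h2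
  rw [add_comm 2 (3 * j)] at h1
  rw [rationalCatalan, show j + 1 + (2 * (j + 1) - 1) - 1 = 3 * j + 1 by omega,
    show 2 * (j + 1) - 1 = 2 * j + 1 by omega]
  have h4 : (3 * j + 2) * ((j + 1) * hittingWalks 2 (3 * j + 2)) =
      (3 * j + 2) * (3 * j + 1).choose (2 * j + 1) := by
    rw [h2]
    linear_combination (j + 1) * h1
  have h5 : ((j : ℚ) + 1) * hittingWalks 2 (3 * j + 2) = (3 * j + 1).choose (2 * j + 1) := by
    exact_mod_cast Nat.eq_of_mul_eq_mul_left (by omega) h4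
  push_cast
  rw [← h5]
  field_simp

open Classical in
/-- The subsets of `(c, c + s]` whose walk, with a step `-1` for an element of the set and `+2` for
any other element of `(c, c + s]`, stays positive when it starts at height `h`: the height after
`t` steps is `h + 2 * t - 3 * |M ∩ (c, c + t]|`. Having the left endpoint `c` as a parameter
allows the first step to be removed without relabelling. -/
noncomputable def prefixBoundedSets (h c s : ℕ) : Finset (Finset ℕ) :=
  (Finset.Ioc c (c + s)).powerset.filter fun M =>
    ∀ t ≤ s, 3 * (M ∩ Finset.Ioc c (c + t)).card < 2 * t + h

theorem mem_prefixBoundedSets {h c s : ℕ} {M : Finset ℕ} :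
    M ∈ prefixBoundedSets h c s ↔ M ⊆ Finset.Ioc c (c + s) ∧
      ∀ t ≤ s, 3 * (M ∩ Finset.Ioc c (c + t)).card < 2 * t + h := by
  classical
  rw [← Finset.mem_powerset]
  exact Finset.mem_filter

theorem mem_prefixBoundedSets_succ {h c s : ℕ} {M : Finset ℕ} (hc : c + 1 ∉ M) :
    M ∈ prefixBoundedSets (h + 1) c (s + 1) ↔ M ∈ prefixBoundedSets (h + 3) (c + 1) s := by
  have hinter : ∀ t, M ∩ Finset.Ioc c (c + (t + 1)) = M ∩ Finset.Ioc (c + 1) (c + 1 + t) := by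
    intro t
    ext x
    simp only [Finset.mem_inter, Finset.mem_Ioc]
    refine and_congr_right fun hx => ?_
    have := ne_of_mem_of_not_mem hx hc
    omega
  rw [mem_prefixBoundedSets, mem_prefixBoundedSets, ← Finset.inter_eq_left, hinter,
    Finset.inter_eq_left]
  refine and_congr_right fun _ => ⟨fun H t ht => ?_, fun H t ht => ?_⟩
  · have := H (t + 1) (by omega)
    rw [hinter] at this
    omega
  · rcases t with _ | t
    · simp
    · have := H t (by omega)
      rw [hinter]
      omega

theorem insert_mem_prefixBoundedSets_succ {h c s : ℕ} {M : Finset ℕ} (hc : c + 1 ∉ M) :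
    insert (c + 1) M ∈ prefixBoundedSets (h + 1) c (s + 1) ↔
      M ∈ prefixBoundedSets h (c + 1) s := by
  have hinter : ∀ t, insert (c + 1) M ∩ Finset.Ioc c (c + (t + 1)) =
      insert (c + 1) (M ∩ Finset.Ioc (c + 1) (c + 1 + t)) := by
    intro t
    ext x
    simp only [Finset.mem_inter, Finset.mem_insert, Finset.mem_Ioc]
    by_cases hx : x = c + 1
    · simp only [hx, true_or, true_and, iff_true]
      omega
    · simp only [hx, false_or]
      refine and_congr_right fun _ => ?_
      omega
  have hcard : ∀ t, (insert (c + 1) M ∩ Finset.Ioc c (c + (t + 1))).card =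
      (M ∩ Finset.Ioc (c + 1) (c + 1 + t)).card + 1 := fun t => by
    rw [hinter, Finset.card_insert_of_notMem (by simp)]
  rw [mem_prefixBoundedSets, mem_prefixBoundedSets]
  refine and_congr ⟨fun H x hx => ?_, fun H x hx => ?_⟩ ⟨fun H t ht => ?_, fun H t ht => ?_⟩
  · have h1 := Finset.mem_Ioc.1 (H (Finset.mem_insert_of_mem hx))
    have h2 := ne_of_mem_of_not_mem hx hc
    rw [Finset.mem_Ioc]
    omega
  · rcases Finset.mem_insert.1 hx with rfl | hx
    · rw [Finset.mem_Ioc]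
      omega
    · have h1 := Finset.mem_Ioc.1 (H hx)
      rw [Finset.mem_Ioc]
      omega
  · have := H (t + 1) (by omega)
    rw [hcard] at this
    omega
  · rcases t with _ | t
    · simp
    · have := H t (by omega)
      rw [hcard]
      omega

theorem card_prefixBoundedSets (h c s : ℕ) :
    (prefixBoundedSets h c s).card = survivingWalks h s := by
  classical
  induction s generalizing h c with
  | zero =>
    cases h with
    | zero => simp [prefixBoundedSets, survivingWalks]
    | succ h => simp [prefixBoundedSets, survivingWalks]
  | succ s ih =>
    cases h with
    | zero =>
      rw [survivingWalks, Finset.card_eq_zero, Finset.eq_empty_iff_forall_notMem]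
      intro M hM
      simpa using (mem_prefixBoundedSets.1 hM).2 0 (by omega)
    | succ h =>
      have hM : ∀ M ⊆ Finset.Ioc (c + 1) (c + 1 + s), c + 1 ∉ M := fun M hM hc => by
        simpa using hM hc
      have hunion : prefixBoundedSets (h + 1) c (s + 1) =
          (prefixBoundedSets h (c + 1) s).image (insert (c + 1)) ∪
            prefixBoundedSets (h + 3) (c + 1) s := by
        ext N
        rw [Finset.mem_union, Finset.mem_image]
        constructor
        · intro hN
          by_cases hc : c + 1 ∈ N
          · refine Or.inl ⟨N.erase (c + 1), ?_, Finset.insert_erase hc⟩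
            rwa [← insert_mem_prefixBoundedSets_succ (Finset.notMem_erase _ _),
              Finset.insert_erase hc]
          · exact Or.inr ((mem_prefixBoundedSets_succ hc).1 hN)
        · rintro (⟨M, hN, rfl⟩ | hN)
          · exact (insert_mem_prefixBoundedSets_succ
              (hM M (mem_prefixBoundedSets.1 hN).1)).2 hN
          · exact (mem_prefixBoundedSets_succ (hM N (mem_prefixBoundedSets.1 hN).1)).2 hN
      rw [hunion, Finset.card_union_of_disjoint, Finset.card_image_of_injOn, ih, ih,
        survivingWalks]
      · intro M hM₁ N hN₁ hMN
        have h1 := hM M (mem_prefixBoundedSets.1 hM₁).1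
        have h2 := hM N (mem_prefixBoundedSets.1 hN₁).1
        rw [← Finset.erase_insert h1, ← Finset.erase_insert h2]
        exact congrArg (Finset.erase · (c + 1)) hMN
      · rw [Finset.disjoint_left]
        intro N hN₁ hN₂
        obtain ⟨M, -, rfl⟩ := Finset.mem_image.1 hN₁
        exact hM _ (mem_prefixBoundedSets.1 hN₂).1 (Finset.mem_insert_self _ _)

/-- The first step is `+2`, as `1` is never a mesa; after it the walk is at height `2`. -/
theorem admissibleMesaSets_succ (s : ℕ) :
    admissibleMesaSets (s + 1) = prefixBoundedSets 2 1 s := by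
  ext M
  rw [mem_admissibleMesaSets_iff, mem_prefixBoundedSets]
  constructor
  · rintro ⟨hM, H⟩
    have h1 : 1 ∉ M := fun h1 => by
      have h2 : 1 ≤ (M ∩ Finset.Icc 1 1).card := Finset.card_pos.2 ⟨1, by simpa using h1⟩
      have h3 := H 1 (by simp)
      omega
    refine ⟨fun x hx => ?_, fun t ht => ?_⟩
    · have h2 := Finset.mem_Icc.1 (hM hx)
      have h3 := ne_of_mem_of_not_mem hx h1
      rw [Finset.mem_Ioc]
      omega
    · have h2 := H (t + 1) (by rw [Finset.mem_Icc]; omega)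
      have h3 : (M ∩ Finset.Ioc 1 (1 + t)).card ≤ (M ∩ Finset.Icc 1 (t + 1)).card := by
        rw [add_comm 1 t]
        gcongr
        exact Finset.Ioc_subset_Icc_self
      omega
  · rintro ⟨hM, H⟩
    refine ⟨fun x hx => ?_, fun t ht => ?_⟩
    · have h2 := Finset.mem_Ioc.1 (hM hx)
      rw [Finset.mem_Icc]
      omega
    · rw [Finset.mem_Icc] at ht
      obtain ⟨t, rfl⟩ : ∃ t', t = t' + 1 := ⟨t - 1, by omega⟩
      have h2 : M ∩ Finset.Icc 1 (t + 1) = M ∩ Finset.Ioc 1 (1 + t) := by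
        ext x
        rw [Finset.mem_inter, Finset.mem_inter, Finset.mem_Icc, Finset.mem_Ioc]
        refine and_congr_right fun hx => ?_
        have := Finset.mem_Ioc.1 (hM hx)
        omega
      rw [h2]
      exact H t (by omega)

/-- For a summand supported on `2 mod 3`, the remainder `r ≤ 2` of the length does not matter. -/
theorem sum_range_three_mul_add (g : ℕ → ℚ) (k r : ℕ) (hr : r ≤ 2)
    (hg : ∀ u, u % 3 ≠ 2 → g u = 0) :
    ∑ u ∈ Finset.range (3 * k + r), g u = ∑ j ∈ Finset.range k, g (3 * j + 2) := by
  induction k with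
  | zero =>
    rw [Finset.sum_range_zero]
    refine Finset.sum_eq_zero fun u hu => hg u ?_
    rw [Finset.mem_range] at hu
    omega
  | succ k ih =>
    rw [Finset.sum_range_succ _ k, ← ih, show 3 * (k + 1) + r = 3 * k + r + 1 + 1 + 1 by ring]
    simp only [Finset.sum_range_succ]
    interval_cases r
    · rw [hg (3 * k + 0) (by omega), hg (3 * k + 0 + 1) (by omega)]
      ring
    · rw [hg (3 * k + 1) (by omega), hg (3 * k + 1 + 1 + 1) (by omega)]
      ring
    · rw [hg (3 * k + 2 + 1) (by omega), hg (3 * k + 2 + 1 + 1) (by omega)]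
      ring

theorem corollary4p9 (n k r : ℕ) (hn : 1 ≤ n) (hr : r ∈ ({0, 1, 2} : Set ℕ))
    (hnkr : n = 3 * k + r) :
    ((admissibleMesaSets n).card : ℚ) =
      2 ^ (n - 1) -
        ∑ i ∈ Finset.range k, 2 ^ (3 * i + r) * rationalCatalan (2 * (k - i) - 1) (k - i) := by
  have hr2 : r ≤ 2 := by
    rcases hr with rfl | rfl | rfl <;> omega
  obtain ⟨s, rfl⟩ : ∃ s, n = s + 1 := ⟨n - 1, by omega⟩
  have h1 := survivingWalks_add_sum 2 s
  rw [← card_prefixBoundedSets 2 1 s, ← admissibleMesaSets_succ] at h1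
  have h2 := congrArg (Nat.cast (R := ℚ)) h1
  push_cast at h2
  rw [hnkr, sum_range_three_mul_add _ k r hr2 fun u hu => by
    rw [hittingWalks_eq_zero fun j hj => hu (by omega)]; simp] at h2
  -- The index `i` of the sum and the index `j` of the first hitting time `3 * j + 2` are related
  -- by `i = k - 1 - j`.
  rw [Nat.add_sub_cancel, ← h2, ← Finset.sum_range_reflect, ← hnkr, eq_sub_iff_add_eq,
    add_right_inj]
  refine Finset.sum_congr rfl fun i hi => ?_
  rw [Finset.mem_range] at hi
  rw [hittingWalks_two, show k - 1 - i + 1 = k - i by omega,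
    show s - (3 * (k - 1 - i) + 2) = 3 * i + r by omega, mul_comm]
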